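/- Throughout, groups are abelian, a cardinal is identified with its initial ordinal, and $\mathrm{Ext}=\mathrm{Ext}^1_{\mathbb Z}$. A group $A$ is a Whitehead group if $\mathrm{Ext}(A,\mathbb Z)=0$. For a regular uncountable cardinal $\kappa$ and $E\subseteq\kappa$, $\diamondsuit_\kappa(E)$ says that there are sets $D_\alpha\subseteq\alpha$ $(\alpha\in E)$ such that for every $X\subseteq\kappa$ the set $\{\alpha\in E: X\cap\alpha=D_\alpha\}$ is stationary in $\kappa$. Let $\mu$ be an infinite cardinal of cofinality $\sigma$ and let $\lambda=\mu^+$. Let $S\subseteq\lambda$ be a set of ordinals of cofinality $\sigma$ and let $\bar\eta=\{\eta_\delta:\delta\in S\}$, where each $\eta_\delta:\sigma\to\delta$ is strictly increasing with range cofinal in $\delta$. If $\sigma>\aleph_0$, let $E$ be a stationary subset of $\sigma$ consisting of limit ordinals of cofinality $\omega$ and let $\bar\zeta=\{\zeta_\nu:\nu\in E\}$, where each $\zeta_\nu:\omega\to\nu$ is strictly increasing with range cofinal in $\nu$. If $\sigma=\aleph_0$, let $E=\{0\}$ and omit $\bar\zeta$ and the symbols $z_{\delta,j}$ below. A group $H$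 is built on $\bar\eta$ and $\bar\zeta$ if $H\cong F/K$, where $F$ is the free abelian group on the symbols $$\{y_{\delta,\nu,n}:\delta\in S,\ \nu\in E,\ n\in\omega\}\cup\{z_{\delta,j}:\delta\in S,\ j\in\sigma\}\cup\{x_\beta:\beta\in\lambda\}$$ and $K$ is the subgroup of $F$ generated by the elements $$w_{\delta,\nu,n}=2y_{\delta,\nu,n+1}-y_{\delta,\nu,n}-z_{\delta,\zeta_\nu(n)}+x_{\eta_\delta(\nu+n)}\qquad(\delta\in S,\ \nu\in E,\ n\in\omega).$$ Theorem. Assume GCH. Let $\lambda=\mu^+$, where $\mu$ is a singular cardinal of cofinality $\sigma<\mu$. Suppose $H$ is built on $\bar\eta=\{\eta_\delta:\delta\in S\}$ and $\bar\zeta=\{\zeta_\nu:\nu\in E\}$ as above, where $S$ is stationary in $\lambda$. Suppose also that $\diamondsuit_\lambda(Y)$ holds for some subset $Y$ of $\lambda$ consisting of limit ordinals of cofinality $\sigma$ and that, if $\sigma>\aleph_0$, $\diamondsuit_\sigma(E)$ holds. If $A$ is a Whitehead group of cardinality $\lambda=\mu^+$, then $\mathrm{Ext}(H,A)\neq 0$.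 -/

import Mathlib

open Cardinal

universe u

/-- The generalized continuum hypothesis. -/
def GCH : Prop :=
  ∀ c : Cardinal.{u}, ℵ₀ ≤ c → (2 : Cardinal.{u}) ^ c = Order.succ c

/-- The set `S` of ordinals is stationary in the ordinal `o`: the part of `S` below `o` meets every
closed unbounded subset of `o`. -/
def StationaryIn (o : Ordinal.{u}) (S : Set Ordinal.{u}) : Prop :=
  IsStationary {α : Set.Iio o | (α : Ordinal.{u}) ∈ S}

/-- The diamond principle `◇_κ(E)`: there are sets `D α ⊆ α` for `α ∈ E` such that for every
`X ⊆ κ` the set of those `α ∈ E` with `X ∩ α = D α` is stationary in `κ`. -/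
def Diamond (κ : Cardinal.{u}) (E : Set Ordinal.{u}) : Prop :=
  ∃ D : Ordinal.{u} → Set Ordinal.{u},
    (∀ α ∈ E, D α ⊆ Set.Iio α) ∧
    ∀ X : Set Ordinal.{u}, X ⊆ Set.Iio κ.ord →
      StationaryIn κ.ord {α | α ∈ E ∧ X ∩ Set.Iio α = D α}

/-- A ladder system on the set `S` of ordinals, with ladders indexed by `I`: for each `δ ∈ S`
a strictly increasing function from `I` to `δ` whose range is cofinal in `δ`. -/
structure LadderSystem (I : Type*) [Preorder I] (S : Set Ordinal.{u}) where
  ladder : (δ : S) → I → Set.Iio (δ : Ordinal.{u})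
  strictMono : ∀ δ, StrictMono (ladder δ)
  cofinal : ∀ δ, IsCofinal (Set.range (ladder δ))

/-- The data from which a group is built: for an infinite cardinal `μ` of cofinality `σ`,
a set `S` of ordinals below `μ⁺` of cofinality `σ` with a ladder system `η` (ladders of length `σ`);
and, if `σ` is uncountable, a stationary subset `E` of `σ` consisting of limit ordinals of
cofinality `ω`, with a ladder system `ζ` (ladders of length `ω`). If `σ` is countable
then `E = {0}` and there is no `ζ`. -/
structure BuildingData (μ : Cardinal.{u}) where
  aleph0_le : ℵ₀ ≤ μ
  S : Set Ordinal.{u}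
  S_lt : ∀ δ ∈ S, δ < (Order.succ μ).ord
  S_cof : ∀ δ ∈ S, δ.cof = μ.ord.cof
  η : LadderSystem (Set.Iio μ.ord.cof.ord) S
  E : Set Ordinal.{u}
  E_lt : ∀ ν ∈ E, ν < μ.ord.cof.ord
  E_eq : μ.ord.cof = ℵ₀ → E = {0}
  E_stationary : ℵ₀ < μ.ord.cof → StationaryIn μ.ord.cof.ord E
  E_cof : ℵ₀ < μ.ord.cof → ∀ ν ∈ E, ν.cof = ℵ₀
  ζ : ℵ₀ < μ.ord.cof → LadderSystem ℕ E

namespace BuildingData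

variable {μ : Cardinal.{u}} (D : BuildingData μ)

/-- The free generators `y_{δ,ν,n}`, `z_{δ,j}` and `x_β`, where the `z_{δ,j}` are
present only if the cofinality of `μ` is uncountable. -/
inductive Gen : Type (u + 1)
  | y (δ : D.S) (ν : D.E) (n : ℕ) : Gen
  | z (hσ : ℵ₀ < μ.ord.cof) (δ : D.S) (j : Set.Iio μ.ord.cof.ord) : Gen
  | x (β : Set.Iio (Order.succ μ).ord) : Gen

/-- The free abelian group `F` on the generators. -/
abbrev F : Type (u + 1) := FreeAbelianGroup D.Gen

/-- The ordinal `ν + n`, as an element of `σ`. -/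
def shift (ν : D.E) (n : ℕ) : Set.Iio μ.ord.cof.ord :=
  ⟨(ν : Ordinal.{u}) + n, by
    have h : ℵ₀ ≤ μ.ord.cof :=
      Ordinal.aleph0_le_cof_iff.2
        (Ordinal.one_lt_cof_iff.2 (Cardinal.isSuccLimit_ord D.aleph0_le))
    exact Ordinal.isPrincipal_add_ord h (D.E_lt ν ν.2)
      ((Ordinal.natCast_lt_omega0 n).trans_le (Cardinal.omega0_le_ord.2 h))⟩

/-- The ordinal `η_δ(i)`, as an element of `μ⁺`. -/
def etaVal (δ : D.S) (i : Set.Iio μ.ord.cof.ord) : Set.Iio (Order.succ μ).ord :=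
  ⟨D.η.ladder δ i, lt_trans (D.η.ladder δ i).2 (D.S_lt δ δ.2)⟩

/-- The ordinal `ζ_ν(n)`, as an element of `σ`. -/
def zetaVal (hσ : ℵ₀ < μ.ord.cof) (ν : D.E) (n : ℕ) : Set.Iio μ.ord.cof.ord :=
  ⟨(D.ζ hσ).ladder ν n, lt_trans ((D.ζ hσ).ladder ν n).2 (D.E_lt ν ν.2)⟩

open Classical in
/-- The element `w_{δ,ν,n} = 2 y_{δ,ν,n+1} - y_{δ,ν,n} - z_{δ,ζ_ν(n)} + x_{η_δ(ν+n)}` of `F`, where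
the `z`-term is omitted if the cofinality of `μ` is countable. -/
noncomputable def w (δ : D.S) (ν : D.E) (n : ℕ) : D.F :=
  (2 : ℤ) • FreeAbelianGroup.of (Gen.y δ ν (n + 1)) - FreeAbelianGroup.of (Gen.y δ ν n)
    - (if hσ : ℵ₀ < μ.ord.cof then FreeAbelianGroup.of (Gen.z hσ δ (D.zetaVal hσ ν n)) else 0)
    + FreeAbelianGroup.of (Gen.x (D.etaVal δ (D.shift ν n)))

/-- The subgroup `K` of `F` generated by the elements `w_{δ,ν,n}`. -/
def K : AddSubgroup D.F :=
  AddSubgroup.closure {a | ∃ δ ν n, a = D.w δ ν n}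

/-- `H` is the group built on the ladder systems `η` and `ζ`. -/
def IsBuiltOn (H : Type*) [AddCommGroup H] : Prop :=
  Nonempty (H ≃+ D.F ⧸ D.K)

end BuildingData

/-- The group `Ext(B, A) = Ext¹_ℤ(B, A)` of abelian groups. -/
abbrev ExtAb (B A : Type u) [AddCommGroup B] [AddCommGroup A] : Type u :=
  CategoryTheory.Abelian.Ext.{u} (ModuleCat.of ℤ B) (ModuleCat.of ℤ A) 1

/-- `A` is a Whitehead group: `Ext(A, ℤ) = 0`. -/
def IsWhitehead (A : Type u) [AddCommGroup A] : Prop :=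
  Subsingleton (ExtAb A (ULift.{u} ℤ))

/-!
Suppose `Ext(H, A) = 0`, so that the elements `w_{δ,ν,n}` can be sent anywhere in `A` by a
homomorphism `φ` from `F`. Write `A` as the union of a chain of smaller subgroups `A_γ`, `γ < μ⁺`.

Since `A` is a Whitehead group, the diamond on `Y` provides arbitrarily large `α` such that
`V / A_α` is a Whitehead group whenever `V` is generated by `A_α` and at most `μ` further elements;
for such `α` the group `A / A_α` is not `2`-divisible. Hence for each `δ ∈ S` there are `α ≥ δ` of
this kind and `b_δ ∉ A_α + 2A`.

There are also `ε_{ν,n} ∈ {0, 1}` such that for all integers `m ≠ 0` and `Z_j` some `ν` admits no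
integers `Y_n` with `2 Y_{n+1} - Y_n = Z_{ζ_ν(n)} + m ε_{ν,n}`. Indeed, for fixed `m`, `Z` and `ν`
each value of `Y_0` is compatible with at most one sequence `ε_ν`, so countably many choices of
`(m, Z)` can be defeated at each `ν`, and the diamond on `σ` guesses `Z` below `ν`.

Let `φ(w_{δ,ν,n}) = ε_{ν,n} b_δ`. As `S` is stationary, there is `δ ∈ S` with `φ(x_β) ∈ A_δ` for all
`β < δ`. A homomorphism `g : A → ℚ` which vanishes on `A_α`, is nonzero at `b_δ`, and has integral
values at `b_δ` and at the images of the `y_{δ,ν,n}` and `z_{δ,j}` turns the relations into a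
solution of the forbidden recursions with `m = g(b_δ)`.
-/

universe v w

section Divisible

variable {A : Type*} [AddCommGroup A] {Q : Type*} [AddCommGroup Q] [DivisibleBy Q ℤ]

theorem exists_addMonoidHom_gluing {ι : Type*} [Preorder ι] [IsDirectedOrder ι]
    {V : ι → AddSubgroup A} (hV : Monotone V) (χ : ι → A →+ Q)
    (hχ : ∀ i j, i ≤ j → ∀ v ∈ V i, χ j v = χ i v) :
    ∃ f : A →+ Q, ∀ i, ∀ v ∈ V i, f v = χ i v := by
  rcases isEmpty_or_nonempty ι with h | h
  · exact ⟨0, isEmptyElim⟩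
  have exists_mem (v : ↥(iSup V)) : ∃ i, (v : A) ∈ V i :=
    (AddSubgroup.mem_iSup_of_directed hV.directed_le).1 v.2
  choose k hk using exists_mem
  have apply_eq (v : ↥(iSup V)) (i : ι) (hi : (v : A) ∈ V i) : χ (k v) v = χ i v := by
    obtain ⟨j, hkj, hij⟩ := exists_ge_ge (k v) i
    rw [← hχ _ _ hkj _ (hk v), hχ _ _ hij _ hi]
  let g : ↥(iSup V) →+ Q := AddMonoidHom.mk' (fun v ↦ χ (k v) v) fun a b ↦ by
    obtain ⟨j, haj, hbj⟩ := exists_ge_ge (k a) (k b)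
    have ha : (a : A) ∈ V j := hV haj (hk a)
    have hb : (b : A) ∈ V j := hV hbj (hk b)
    rw [apply_eq (a + b) j (add_mem ha hb), apply_eq a j ha, apply_eq b j hb,
      AddSubgroup.coe_add, map_add]
  obtain ⟨f, hf⟩ := (Module.Baer.of_divisible Q).extension_property_addMonoidHom
    (iSup V).subtype (AddSubgroup.subtype_injective _) g
  exact ⟨f, fun i v hv ↦
    (DFunLike.congr_fun hf ⟨v, le_iSup V i hv⟩).trans (apply_eq ⟨v, le_iSup V i hv⟩ i hv)⟩

theorem exists_addMonoidHom_tower {ι : Type*} [LinearOrder ι] [WellFoundedLT ι]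
    {V V' : ι → AddSubgroup A} (hV : ∀ i, V i ≤ V' i) (hVV' : ∀ i j, i < j → V' i ≤ V j)
    (Φ : ι → (A →+ Q) → A →+ Q) (hΦ : ∀ i χ, ∀ v ∈ V i, Φ i χ v = χ v) :
    ∃ ψ : A →+ Q, ∀ i, ∃ χ, ∀ v ∈ V' i, ψ v = Φ i χ v := by
  have hV' : Monotone V' := fun i j hij ↦
    hij.eq_or_lt.elim (fun h ↦ h ▸ le_rfl) fun h ↦ (hVV' i j h).trans (hV j)
  have exists_glue (i : ι) (P : Set.Iio i → A →+ Q) : ∃ χ : A →+ Q,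
      (∀ j k : Set.Iio i, j ≤ k → ∀ v ∈ V' j, P k v = P j v) →
        ∀ j : Set.Iio i, ∀ v ∈ V' j, χ v = P j v := by
    by_cases hP : ∀ j k : Set.Iio i, j ≤ k → ∀ v ∈ V' j, P k v = P j v
    · obtain ⟨χ, hχ⟩ := exists_addMonoidHom_gluing (V := fun j : Set.Iio i ↦ V' j)
        (fun _ _ h ↦ hV' h) P hP
      exact ⟨χ, fun _ ↦ hχ⟩
    · exact ⟨0, fun h ↦ absurd h hP⟩
  choose glue hglue using exists_glue
  let P : ι → A →+ Q := wellFounded_lt.fix fun i rec ↦ glue i fun j ↦ Φ j (rec j j.2)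
  have hP (i : ι) : P i = glue i fun j ↦ Φ j (P j) := WellFounded.fix_eq _ _ i
  have coherent {k : ι} (hk : ∀ j < k, ∀ v ∈ V' j, P k v = Φ j (P j) v) (j : ι) (hjk : j ≤ k)
      (v : A) (hv : v ∈ V' j) : Φ k (P k) v = Φ j (P j) v := by
    rcases hjk.eq_or_lt with rfl | h
    · rfl
    · rw [hΦ k _ v (hVV' j k h hv), hk j h v hv]
  have P_apply (i : ι) : ∀ j < i, ∀ v ∈ V' j, P i v = Φ j (P j) v := by
    induction i using WellFoundedLT.induction with
    | _ i ih =>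
      intro j hj v hv
      rw [hP i]
      exact hglue i _ (fun j k hjk ↦ coherent (ih k k.2) j hjk) ⟨j, hj⟩ v hv
  obtain ⟨ψ, hψ⟩ := exists_addMonoidHom_gluing hV' (fun i ↦ Φ i (P i))
    fun j k ↦ coherent (P_apply k) j
  exact ⟨ψ, fun i ↦ ⟨P i, hψ i⟩⟩

theorem exists_addMonoidHom_rat {p : ℤ} (hp : p ≠ 0) {c : ℕ → Q}
    (hc : ∀ n, p • c (n + 1) = c n) : ∃ κ : ℚ →+ Q, ∀ n, κ (1 / p ^ n) = c n := by
  have exists_apply_eq (n : ℕ) : ∃ χ : ℚ →+ Q, χ (1 / p ^ n) = c n := by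
    obtain ⟨χ, hχ⟩ := (Module.Baer.of_divisible Q).extension_property_addMonoidHom
      (zmultiplesHom ℚ (1 / p ^ n)) (fun a b hab ↦ by simpa [hp] using hab) (zmultiplesHom Q (c n))
    exact ⟨χ, by simpa using DFunLike.congr_fun hχ 1⟩
  choose χ hχ using exists_apply_eq
  have zsmul_succ (n : ℕ) : (1 / p ^ n : ℚ) = p • (1 / p ^ (n + 1) : ℚ) := by
    have : (p : ℚ) ≠ 0 := mod_cast hp
    rw [zsmul_eq_mul, pow_succ]
    field_simp
  have hV : Monotone fun n ↦ AddSubgroup.zmultiples (1 / p ^ n : ℚ) :=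
    monotone_nat_of_le_succ fun n ↦ by
      rw [AddSubgroup.zmultiples_le, zsmul_succ n]
      exact AddSubgroup.zsmul_mem_zmultiples _ _
  have apply_eq (m n : ℕ) (hmn : m ≤ n) : χ n (1 / p ^ m) = c m := by
    induction hmn using Nat.decreasingInduction with
    | self => exact hχ n
    | of_succ k _ ih => rw [zsmul_succ k, map_zsmul, ih, hc]
  obtain ⟨κ, hκ⟩ := exists_addMonoidHom_gluing hV χ fun m n hmn v hv ↦ by
    obtain ⟨z, rfl⟩ := AddSubgroup.mem_zmultiples_iff.1 hv
    rw [map_zsmul, map_zsmul, apply_eq m n hmn, hχ]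
  exact ⟨κ, fun n ↦ (hκ n _ (AddSubgroup.mem_zmultiples _)).trans (hχ n)⟩

end Divisible

theorem addCircle_one_coe_eq_coe_iff {x y : ℚ} :
    (x : AddCircle (1 : ℚ)) = y ↔ ∃ z : ℤ, x - y = z := by
  rw [← sub_eq_zero, ← AddCircle.coe_sub, AddCircle.coe_eq_zero_iff]
  simp only [zsmul_one, eq_comm]

theorem exists_character_of_notMem {A : Type*} [AddCommGroup A] {U : AddSubgroup A} {a : A}
    (ha : a ∉ U) : ∃ c : A →+ AddCircle (1 : ℚ), (∀ u ∈ U, c u = 0) ∧ c a ≠ 0 := by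
  obtain ⟨c, hc⟩ := CharacterModule.exists_character_apply_ne_zero_of_ne_zero
    (a := (a : A ⧸ U)) (by rwa [ne_eq, QuotientAddGroup.eq_zero_iff])
  exact ⟨AddMonoidHom.comp (show A ⧸ U →+ _ from c) (QuotientAddGroup.mk' U), fun u hu ↦
    (congrArg c ((QuotientAddGroup.eq_zero_iff u).2 hu)).trans (map_zero c), hc⟩

theorem exists_injective_hom_divisible (A : Type u) [AddCommGroup A] :
    ∃ (I : Type u) (_ : AddCommGroup I) (_ : DivisibleBy I ℤ) (i : A →+ I),
      Function.Injective i := by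
  refine ⟨(A →+ AddCircle (1 : ℚ)) → AddCircle (1 : ℚ), inferInstance, inferInstance,
    AddMonoidHom.pi fun c ↦ c, ?_⟩
  rw [injective_iff_map_eq_zero]
  exact fun x hx ↦ CharacterModule.eq_zero_of_character_apply fun c ↦ congrFun hx c

/-- The recursion `p * Y (n + 1) - Y n = t n` has a solution in the integers. Equivalently, the
`p`-adic integer `∑ p ^ n * t n` is an integer, namely `-Y 0`. -/
def RecursionSolvable (p : ℤ) (t : ℕ → ℤ) : Prop :=
  ∃ Y : ℕ → ℤ, ∀ n, p * Y (n + 1) - Y n = t n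

section Recursion

variable {p : ℤ}

theorem exists_coprime_pow_mul_eq_of_recursion {m : ℤ} {d e : ℕ → ℤ} {k : ℕ}
    (h : ∀ n, p * d (n + 1) - d n = m * e n) (hk : d k = 0) (hek : IsCoprime p (e k)) (j : ℕ) :
    ∃ q, IsCoprime p q ∧ p ^ (j + 1) * d (k + j + 1) = m * q := by
  induction j with
  | zero => exact ⟨e k, hek, by simpa [hk] using h k⟩
  | succ j ih =>
    obtain ⟨q, hq, hj⟩ := ih
    refine ⟨q + p * (p ^ j * e (k + j + 1)), hq.add_mul_left_right _, ?_⟩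
    linear_combination hj + p ^ (j + 1) * h (k + j + 1)

theorem eq_zero_of_recursion (hp : 1 < p.natAbs) {m : ℤ} {d e : ℕ → ℤ} {k : ℕ}
    (h : ∀ n, p * d (n + 1) - d n = m * e n) (hk : d k = 0) (hek : IsCoprime p (e k)) :
    m = 0 := by
  have pow_dvd (j : ℕ) : p ^ j ∣ m := by
    obtain ⟨q, hq, hj⟩ := exists_coprime_pow_mul_eq_of_recursion h hk hek j
    exact (pow_dvd_pow p j.le_succ).trans (hq.pow_left.dvd_of_dvd_mul_right ⟨_, hj.symm⟩)
  by_contra hm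
  exact FiniteMultiplicity.not_iff_forall.2 pow_dvd (Int.finiteMultiplicity_iff.2 ⟨hp.ne', hm⟩)

theorem recursion_coeff_unique (hp : 1 < p.natAbs) {m : ℤ} (hm : m ≠ 0) {t Y Y' : ℕ → ℤ}
    {ε ε' : ℕ → Bool} (h : ∀ n, p * Y (n + 1) - Y n = t n + m * (ε n).toNat)
    (h' : ∀ n, p * Y' (n + 1) - Y' n = t n + m * (ε' n).toNat) (h0 : Y 0 = Y' 0) : ε = ε' := by
  have sub_recursion (n : ℕ) : p * (Y (n + 1) - Y' (n + 1)) - (Y n - Y' n) =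
      m * ((ε n).toNat - (ε' n).toNat) := by
    linear_combination h n - h' n
  have coeff_eq (n : ℕ) (hn : Y n = Y' n) : ε n = ε' n := by
    by_contra hne
    refine hm (eq_zero_of_recursion (d := fun n ↦ Y n - Y' n)
      (e := fun n ↦ (ε n).toNat - (ε' n).toNat) hp sub_recursion (sub_eq_zero.2 hn) ?_)
    cases hε : ε n <;> cases hε' : ε' n <;> simp_all [isCoprime_one_right, IsCoprime.neg_right_iff]
  have hY (n : ℕ) : Y n = Y' n := by
    induction n with
    | zero => exact h0
    | succ n ih =>
      have hp0 : p ≠ 0 := by rintro rfl; simp at hp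
      refine mul_left_cancel₀ hp0 ?_
      linear_combination h n - h' n + ih + m * congrArg (fun b ↦ (b.toNat : ℤ)) (coeff_eq n ih)
  exact funext fun n ↦ coeff_eq n (hY n)

theorem exists_forall_not_recursionSolvable (hp : 1 < p.natAbs) {J : Type*} [Countable J]
    (t : J → ℕ → ℤ) {m : J → ℤ} (hm : ∀ j, m j ≠ 0) :
    ∃ ε : ℕ → Bool, ∀ j, ¬ RecursionSolvable p fun n ↦ t j n + m j * (ε n).toNat := by
  by_contra! hcon
  choose j Y hY using hcon
  have hinj : Function.Injective fun ε : ℕ → Bool ↦ (j ε, Y ε 0) := fun ε ε' h ↦ by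
    obtain ⟨hj, h0⟩ := Prod.mk.inj h
    exact recursion_coeff_unique hp (hm (j ε')) (hj ▸ hY ε) (hY ε') h0
  have := mk_le_aleph0_iff.2 hinj.countable
  simp only [mk_pi, mk_bool, prod_const, mk_nat, lift_id] at this
  exact this.not_gt (cantor ℵ₀)

-- `κ (1 / p ^ n)` is the `n`-th partial sum of a `p`-adic integer `x`, divided by `p ^ n`; a lift
-- `r` would make `r - x` divisible by every power of `p`, so that `x = r` is rational integral.
theorem exists_character_rat_not_liftable (hp : 1 < p.natAbs) :
    ∃ κ : ℚ →+ AddCircle (1 : ℚ), ∀ r : ℚ, ∃ n : ℕ,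
      ((r / p ^ n : ℚ) : AddCircle (1 : ℚ)) ≠ κ (1 / p ^ n) := by
  have hp0 : (p : ℚ) ≠ 0 := by rintro h; simp_all
  obtain ⟨ε, hε⟩ := exists_forall_not_recursionSolvable hp (J := Unit) (fun _ _ ↦ 0)
    (m := fun _ ↦ -1) (by simp)
  let s (n : ℕ) : ℚ := ∑ k ∈ Finset.range n, p ^ k * (ε k).toNat
  have s_succ (n : ℕ) : s (n + 1) = s n + p ^ n * (ε n).toNat := Finset.sum_range_succ _ _
  obtain ⟨κ, hκ⟩ := exists_addMonoidHom_rat (Q := AddCircle (1 : ℚ)) (mod_cast hp0)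
    (c := fun n ↦ (s n / p ^ n : ℚ)) fun n ↦ by
      rw [← AddCircle.coe_zsmul, addCircle_one_coe_eq_coe_iff]
      refine ⟨(ε n).toNat, ?_⟩
      simp only [s_succ, zsmul_eq_mul, pow_succ, Int.cast_natCast]
      field_simp
      ring
  refine ⟨κ, fun r ↦ ?_⟩
  by_contra! hr
  have integral (n : ℕ) : ∃ Y : ℤ, (r - s n) / p ^ n = Y := by
    rw [sub_div]
    exact addCircle_one_coe_eq_coe_iff.1 ((hr n).trans (hκ n))
  choose Y hY using integral
  refine hε () ⟨Y, fun n ↦ ?_⟩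
  have : (p * Y (n + 1) - Y n : ℚ) = -(ε n).toNat := by
    rw [← hY, ← hY, s_succ, pow_succ]
    field_simp
    ring
  beta_reduce
  rw [zero_add, neg_one_mul]
  exact_mod_cast this

end Recursion

theorem map_eq_div_pow_of_sub_zsmul_mem {A : Type*} [AddCommGroup A] {U : AddSubgroup A} {p : ℤ}
    (hp : p ≠ 0) {y : ℕ → A} (hy : ∀ n, y n - p • y (n + 1) ∈ U) {g : A →+ ℚ}
    (hg : ∀ u ∈ U, g u = 0) (n : ℕ) : g (y n) = g (y 0) / p ^ n := by
  have hp' : (p : ℚ) ≠ 0 := mod_cast hp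
  induction n with
  | zero => simp
  | succ n ih =>
    have := hg _ (hy n)
    rw [map_sub, map_zsmul, ih, zsmul_eq_mul, sub_eq_zero] at this
    rw [pow_succ, ← div_div, this]
    field_simp

/-- For `V` the subgroup generated by `U` and `T`, the group `V ⧸ U` is a Whitehead group, in the
form of the lifting property for homomorphisms to `ℚ/ℤ`. These homomorphisms can be taken on all of
`A`, since they extend from `V` by divisibility, and so can their lifts. -/
def RelWhitehead {A : Type*} [AddCommGroup A] (U : AddSubgroup A) (T : Set A) : Prop :=
  ∀ f : A →+ AddCircle (1 : ℚ), (∀ u ∈ U, f u = 0) →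
    ∃ g : A →+ ℚ, (∀ u ∈ U, g u = 0) ∧ ∀ v ∈ T, ((g v : ℚ) : AddCircle (1 : ℚ)) = f v

namespace RelWhitehead

variable {A : Type*} [AddCommGroup A] {U : AddSubgroup A} {T : Set A} {p : ℤ}

theorem mono {T' : Set A} (h : RelWhitehead U T') (hT : T ⊆ T') : RelWhitehead U T :=
  fun f hf ↦ (h f hf).imp fun _ hg ↦ ⟨hg.1, fun v hv ↦ hg.2 v (hT hv)⟩

-- Otherwise `A ⧸ U` is `p`-divisible, hence has a nonzero homomorphic image of `ℤ[1/p]`, on which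
-- a non-liftable character can be imposed.
theorem exists_notMem_sup_range_zsmul (hp : 1 < p.natAbs) (hU : U ≠ ⊤)
    (h : ∀ T : Set A, T.Countable → RelWhitehead U T) :
    ∃ b, b ∉ U ⊔ (zsmulAddGroupHom p : A →+ A).range := by
  by_contra! hcon
  have hp0 : p ≠ 0 := by rintro rfl; simp at hp
  obtain ⟨y₀, hy₀⟩ : ∃ y₀, y₀ ∉ U := by
    by_contra! hall
    exact hU (eq_top_iff.2 fun x _ ↦ hall x)
  have exists_root (b : A) : ∃ a, b - p • a ∈ U := by
    obtain ⟨u, hu, _, ⟨a, rfl⟩, hb⟩ := AddSubgroup.mem_sup.1 (hcon b)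
    exact ⟨a, by rwa [← hb, zsmulAddGroupHom_apply, add_sub_cancel_right]⟩
  choose q hq using exists_root
  let y (n : ℕ) : A := q^[n] y₀
  have hy (n : ℕ) : y n - p • y (n + 1) ∈ U := by
    simpa only [y, Function.iterate_succ_apply'] using hq (y n)
  have hW := h (Set.range y) (Set.countable_range y)
  obtain ⟨c, hcU, hc⟩ := exists_character_of_notMem hy₀
  obtain ⟨g, hgU, hg⟩ := hW c hcU
  have hg0 : g (y 0) ≠ 0 := fun h0 ↦
    hc ((hg (y 0) ⟨0, rfl⟩).symm.trans (by rw [h0, AddCircle.coe_zero]))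
  obtain ⟨κ, hκ⟩ := exists_character_rat_not_liftable hp
  obtain ⟨g', hg'U, hg'⟩ := hW (κ.comp ((AddMonoidHom.mulLeft (g (y 0))⁻¹).comp g)) fun u hu ↦ by
    simp [hgU u hu]
  obtain ⟨n, hn⟩ := hκ (g' (y 0))
  refine hn ?_
  rw [← map_eq_div_pow_of_sub_zsmul_mem hp0 hy hg'U, hg' _ ⟨n, rfl⟩]
  simp only [AddMonoidHom.comp_apply, AddMonoidHom.coe_mulLeft,
    map_eq_div_pow_of_sub_zsmul_mem hp0 hy hgU n]
  congr 1
  field_simp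

theorem exists_integral (h : RelWhitehead U T) (hp : p ≠ 0) {b : A} (hbT : b ∈ T)
    (hb : b ∉ U ⊔ (zsmulAddGroupHom p : A →+ A).range) :
    ∃ g : A →+ ℚ, (∀ u ∈ U, g u = 0) ∧ (∀ v ∈ T, ∃ z : ℤ, g v = z) ∧ g b ≠ 0 := by
  obtain ⟨c, hc, hcb⟩ := exists_character_of_notMem hb
  obtain ⟨g, hgU, hg⟩ := h c fun u hu ↦ hc u (AddSubgroup.mem_sup_left hu)
  have coe_zsmul_eq_zero {v : A} (hv : v ∈ T) : ((p • g v : ℚ) : AddCircle (1 : ℚ)) = (0 : ℚ) := by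
    rw [AddCircle.coe_zsmul, hg v hv, ← map_zsmul]
    exact hc _ (AddSubgroup.mem_sup_right ⟨v, rfl⟩)
  refine ⟨p • g, fun u hu ↦ by simp [hgU u hu], fun v hv ↦ ?_, fun h0 ↦ ?_⟩
  · simpa using addCircle_one_coe_eq_coe_iff.1 (coe_zsmul_eq_zero hv)
  · have hgb : g b = 0 := by simpa [hp] using h0
    exact hcb ((hg b hbT).symm.trans (by rw [hgb, AddCircle.coe_zero]))

-- If `χ` is bad nothing is to be done; otherwise change it by a character `θ` vanishing on
-- `closure s` without a lift: lifts of `χ` and `χ + θ` extending `k` would differ by a lift of `θ`.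
theorem exists_not_extendable_of_not {s : Set A} (h : ¬ RelWhitehead (AddSubgroup.closure s) T)
    (k : A → ℚ) (χ : A →+ AddCircle (1 : ℚ)) :
    ∃ χ' : A →+ AddCircle (1 : ℚ), (∀ u ∈ AddSubgroup.closure s, χ' u = χ u) ∧
      ¬ ∃ g : A →+ ℚ, (∀ u ∈ s, g u = k u) ∧ ∀ v ∈ T, ((g v : ℚ) : AddCircle (1 : ℚ)) = χ' v := by
  by_cases hχ : ∃ g : A →+ ℚ, (∀ u ∈ s, g u = k u) ∧
      ∀ v ∈ T, ((g v : ℚ) : AddCircle (1 : ℚ)) = χ v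
  · obtain ⟨g, hgs, hgT⟩ := hχ
    unfold RelWhitehead at h
    push Not at h
    obtain ⟨θ, hθ, hθT⟩ := h
    refine ⟨χ + θ, fun u hu ↦ by simp [hθ u hu], ?_⟩
    rintro ⟨g', hgs', hgT'⟩
    have closure_le_ker : AddSubgroup.closure s ≤ (g' - g).ker :=
      (AddSubgroup.closure_le _).2 fun u hu ↦ by
        simp [AddMonoidHom.mem_ker, hgs u hu, hgs' u hu]
    obtain ⟨v, hv, hne⟩ := hθT (g' - g) closure_le_ker
    refine hne ?_
    rw [AddMonoidHom.sub_apply, AddCircle.coe_sub, hgT v hv, hgT' v hv, AddMonoidHom.add_apply,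
      add_sub_cancel_left]
  · exact ⟨χ, fun _ _ ↦ rfl, hχ⟩

end RelWhitehead

theorem exists_forall_lt_of_lift_mk_lt_cof {κ : Type v} [LinearOrder κ] {ι : Type w}
    (h : lift.{v} #ι < lift.{w} (Order.cof κ)) (g : ι → κ) : ∃ b, ∀ i, g i < b := by
  by_contra! hg
  have isCofinal_range : IsCofinal (Set.range g) := fun b ↦
    let ⟨i, hi⟩ := hg b
    ⟨g i, ⟨i, rfl⟩, hi⟩
  exact h.not_ge ((lift_le.2 (Order.cof_le isCofinal_range)).trans mk_range_le_lift)

theorem isRegularCardinalOrder_Iio_ord {c : Cardinal.{u}} (hc : c.IsRegular) :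
    IsRegularCardinalOrder (Set.Iio c.ord) where
  type_lt_le_ord_cof := by
    rw [Ordinal.cof_Iio, ← Ordinal.lift_cof, hc.cof_ord, Ordinal.type_lt_Iio, lift_ord]

/-- Jensen's diamond principle `◇(E)` on a well-ordered type `κ`, which plays the role of a regular
uncountable cardinal. -/
def DiamondOn {κ : Type*} [LinearOrder κ] (E : Set κ) : Prop :=
  ∃ D : κ → Set κ, ∀ X : Set κ, IsStationary {α ∈ E | X ∩ Set.Iio α = D α}

theorem Diamond.diamondOn {c : Cardinal.{u}} {E : Set Ordinal.{u}} (h : Diamond c E) :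
    DiamondOn (Subtype.val ⁻¹' E : Set (Set.Iio c.ord)) := by
  obtain ⟨D, -, hD⟩ := h
  refine ⟨fun α ↦ Subtype.val ⁻¹' D α, fun X ↦ (hD (Subtype.val '' X) ?_).mono ?_⟩
  · exact Subtype.coe_image_subset _ _
  · rintro α ⟨hα, hX⟩
    refine ⟨hα, ?_⟩
    change X ∩ Set.Iio α = Subtype.val ⁻¹' D α
    rw [← hX, Set.preimage_inter, Set.preimage_image_eq _ Subtype.val_injective]
    rfl

section RegularCardinalOrder

variable {κ : Type v} [LinearOrder κ] [WellFoundedLT κ] [IsRegularCardinalOrder κ]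

theorem exists_forall_le_apply_lt (hκ : ℵ₀ < #κ) (f : κ → κ) (x : κ) :
    ∃ b, ∀ k ≤ x, f k < b := by
  obtain ⟨b, hb⟩ := exists_forall_lt_of_lift_mk_lt_cof (ι := Set.Iic x) (κ := κ)
    (by simpa using mk_Iic_lt x ord_cardinalMk hκ.le) fun k ↦ f k
  exact ⟨b, fun k hk ↦ hb ⟨k, hk⟩⟩

theorem isClub_setOf_forall_lt_apply_lt (hκ : ℵ₀ < #κ) (f : κ → κ) :
    IsClub {γ | ∀ k < γ, f k < γ} := by
  refine ⟨fun d hd _ _ a ha k hk ↦ ?_, fun a ↦ ?_⟩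
  · obtain ⟨x, hx, hkx⟩ := (lt_isLUB_iff ha).1 hk
    exact (hd hx k hkx).trans_le (ha.1 hx)
  · choose b hb using exists_forall_le_apply_lt hκ f
    let s (n : ℕ) : κ := b^[n] a
    have s_succ (n : ℕ) : s (n + 1) = b (s n) := Function.iterate_succ_apply' b n a
    obtain ⟨γ, hsγ, hγ⟩ := wellFounded_lt.has_min {c | ∀ n, s n < c}
      (exists_forall_lt_of_lift_mk_lt_cof (by simpa using hκ) s)
    refine ⟨γ, fun k hk ↦ ?_, (hsγ 0).le⟩
    obtain ⟨n, hn⟩ : ∃ n, k ≤ s n := by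
      by_contra! hcon
      exact hγ k hcon hk
    exact ((hb _ k hn).trans_eq (s_succ n).symm).trans (hsγ _)

namespace DiamondOn

variable {E : Set κ}

theorem exists_function_guess (hE : DiamondOn E) (hκ : ℵ₀ < #κ) {C : Type w} [Nonempty C]
    (hC : lift.{v} #C ≤ lift.{w} #κ) :
    ∃ h : κ → κ → C, ∀ g : κ → C, IsStationary {γ ∈ E | ∀ k < γ, h γ k = g k} := by
  obtain ⟨code⟩ : Nonempty (κ × C ↪ κ) := by
    rw [← lift_mk_le', mk_prod, lift_mul, lift_lift, lift_lift, lift_umax.{v, w}]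
    exact mul_le_of_le (aleph0_le_lift.2 hκ.le) le_rfl hC
  obtain ⟨D, hD⟩ := hE
  refine ⟨fun γ k ↦ Classical.epsilon fun c ↦ code (k, c) ∈ D γ, fun g t ht ↦ ?_⟩
  obtain ⟨γ, ⟨hγE, hγ⟩, hγt, hclosed⟩ := hD (Set.range fun k ↦ code (k, g k))
    (ht.inter (by simpa using hκ.ne') (isClub_setOf_forall_lt_apply_lt hκ fun k ↦ code (k, g k)))
  refine ⟨γ, ⟨hγE, fun k hk ↦ ?_⟩, hγt⟩
  have mem_D : code (k, g k) ∈ D γ := hγ ▸ ⟨⟨k, rfl⟩, hclosed k hk⟩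
  have mem_range := Classical.epsilon_spec (p := fun c ↦ code (k, c) ∈ D γ) ⟨_, mem_D⟩
  obtain ⟨⟨k', hk'⟩, -⟩ := hγ.superset mem_range
  obtain ⟨rfl, h⟩ := Prod.mk.inj (code.injective hk')
  exact h.symm

theorem exists_coloring_not_recursionSolvable (hE : DiamondOn E) (hκ : ℵ₀ < #κ) {p : ℤ}
    (hp : 1 < p.natAbs) {ζ : E → ℕ → κ} (hζ : ∀ ν n, ζ ν n < ν) :
    ∃ ε : E → ℕ → Bool, ∀ m : ℤ, m ≠ 0 → ∀ Z : κ → ℤ,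
      ∃ ν, ¬ RecursionSolvable p fun n ↦ Z (ζ ν n) + m * (ε ν n).toNat := by
  obtain ⟨h, hh⟩ := hE.exists_function_guess hκ (C := ℤ) (by simpa using hκ.le)
  choose ε hε using fun ν : E ↦ exists_forall_not_recursionSolvable hp
    (fun (_ : {m : ℤ // m ≠ 0}) n ↦ h ν (ζ ν n)) (m := Subtype.val) Subtype.prop
  refine ⟨ε, fun m hm Z ↦ ?_⟩
  obtain ⟨γ, hγ, hg⟩ := (hh Z).nonempty
  refine ⟨⟨γ, hγ⟩, ?_⟩
  simp only [← hg _ (hζ ⟨γ, hγ⟩ _)]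
  exact hε ⟨γ, hγ⟩ ⟨m, hm⟩

end DiamondOn

end RegularCardinalOrder

theorem isClub_Ici {κ : Type*} [LinearOrder κ] (a : κ) : IsClub (Set.Ici a) :=
  ⟨fun _ hd ⟨_, hx⟩ _ _ hb ↦ (hd hx).trans (hb.1 hx),
    fun b ↦ ⟨max a b, le_max_left a b, le_max_right a b⟩⟩

theorem mk_addSubgroupClosure_le {A : Type*} [AddCommGroup A] (s : Set A) :
    #(AddSubgroup.closure s) ≤ max #s ℵ₀ := by
  rcases s.eq_empty_or_nonempty with rfl | hs
  · rw [AddSubgroup.closure_empty]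
    exact mk_le_aleph0.trans (le_max_right _ _)
  · have := hs.to_subtype
    have closure_le_range : AddSubgroup.closure s ≤
        (FreeAbelianGroup.lift (Subtype.val : s → A)).range :=
      (AddSubgroup.closure_le _).2 fun x hx ↦
        ⟨FreeAbelianGroup.of ⟨x, hx⟩, FreeAbelianGroup.lift_apply_of _ _⟩
    exact (mk_le_mk_of_subset closure_le_range).trans (mk_range_le.trans (mk_freeAbelianGroup _).le)

/-- The filtration of a group `A` by the subgroups generated by the elements of rank less than `γ`,
for a ranking `rk` of the elements of `A`. -/
def rankFiltration {A κ : Type*} [AddCommGroup A] [LT κ] (rk : A → κ) (γ : κ) : AddSubgroup A :=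
  AddSubgroup.closure {x | rk x < γ}

section rankFiltration

variable {A : Type w} [AddCommGroup A] {κ : Type v} [LinearOrder κ]

theorem rankFiltration_mono (rk : A → κ) : Monotone (rankFiltration rk) :=
  fun _ _ h ↦ AddSubgroup.closure_mono fun _ hx ↦ lt_of_lt_of_le hx h

theorem mem_rankFiltration {rk : A → κ} {γ : κ} {x : A} (hx : rk x < γ) :
    x ∈ rankFiltration rk γ :=
  AddSubgroup.subset_closure hx

variable [WellFoundedLT κ] [IsRegularCardinalOrder κ]

theorem rankFiltration_ne_top (hκ : ℵ₀ < #κ) (rk : A ≃ κ) (γ : κ) : rankFiltration rk γ ≠ ⊤ := by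
  intro h
  have mk_eq : lift.{v} #A = lift.{w} #κ := lift_mk_eq'.2 ⟨rk⟩
  have mk_lt : #{x | rk x < γ} < #A := by
    rw [← lift_lt.{w, v}, mk_eq]
    exact (mk_preimage_equiv_lift rk (Set.Iio γ)).trans_lt
      (lift_lt.2 (mk_Iio_lt γ ord_cardinalMk))
  have aleph0_lt : ℵ₀ < #A := by rwa [← lift_lt.{w, v}, mk_eq, lift_aleph0, aleph0_lt_lift]
  refine (mk_addSubgroupClosure_le {x | rk x < γ}).not_gt ((max_lt mk_lt aleph0_lt).trans_eq ?_)
  rw [← rankFiltration, h]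
  exact mk_univ.symm

-- Otherwise every stage `α ≥ δ` has a bad `f α`, and a character of `A` is built along the stages
-- closed under `f` so that, at each of them, no lift extends the function guessed by the diamond.
-- Then it has no lift at all.
theorem DiamondOn.exists_forall_relWhitehead {Y : Set κ} (hY : DiamondOn Y) (hκ : ℵ₀ < #κ)
    (hA : RelWhitehead (⊥ : AddSubgroup A) Set.univ) {rk : A → κ} (hrk : Function.Injective rk)
    (δ : κ) :
    ∃ α, δ ≤ α ∧ ∀ β, RelWhitehead (rankFiltration rk α) {x | rk x < β} := by
  by_contra! hcon
  have exists_bad (α : κ) :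
      ∃ β, α ≤ β ∧ (δ ≤ α → ¬ RelWhitehead (rankFiltration rk α) {x | rk x < β}) := by
    by_cases hα : δ ≤ α
    · obtain ⟨β, hβ⟩ := hcon α hα
      exact ⟨max α β, le_max_left _ _, fun _ h ↦ hβ (h.mono fun x hx ↦ lt_max_of_lt_right hx)⟩
    · exact ⟨α, le_rfl, fun h ↦ absurd h hα⟩
  choose f le_f hf using exists_bad
  obtain ⟨h, hh⟩ := hY.exists_function_guess hκ (C := ℚ) (by simpa using hκ.le)
  let ι := {γ // δ ≤ γ ∧ ∀ k < γ, f k < γ}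
  choose Φ hΦ hΦ' using fun i : ι ↦
    RelWhitehead.exists_not_extendable_of_not (hf i i.2.1) fun x ↦ h i (rk x)
  obtain ⟨ψ, hψ⟩ := exists_addMonoidHom_tower (V := fun i : ι ↦ rankFiltration rk i)
    (V' := fun i : ι ↦ rankFiltration rk (f i)) (fun i ↦ rankFiltration_mono rk (le_f i))
    (fun i j hij ↦ rankFiltration_mono rk (j.2.2 i hij).le) Φ hΦ
  obtain ⟨g, -, hg⟩ := hA ψ (by simp)
  obtain ⟨γ, ⟨-, hγ⟩, hclosed, hδ⟩ := hh (Function.extend rk g 0)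
    ((isClub_setOf_forall_lt_apply_lt hκ f).inter (by simpa using hκ.ne') (isClub_Ici δ))
  obtain ⟨χ, hχ⟩ := hψ ⟨γ, hδ, hclosed⟩
  refine hΦ' ⟨γ, hδ, hclosed⟩ χ ⟨g, fun x hx ↦ ?_, fun v hv ↦ ?_⟩
  · exact ((hγ (rk x) hx).trans (hrk.extend_apply g 0 x)).symm
  · rw [hg v trivial, hχ v (mem_rankFiltration hv)]

theorem DiamondOn.exists_rankFiltration_le {Y : Set κ} (hY : DiamondOn Y) (hκ : ℵ₀ < #κ)
    (hA : RelWhitehead (⊥ : AddSubgroup A) Set.univ) (rk : A ≃ κ) {p : ℤ}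
    (hp : 1 < p.natAbs) (δ : κ) :
    ∃ U b, rankFiltration rk δ ≤ U ∧ (∀ T : Set A, #T < #A → RelWhitehead U T) ∧
      b ∉ U ⊔ (zsmulAddGroupHom p : A →+ A).range := by
  obtain ⟨α, hδα, hα⟩ := hY.exists_forall_relWhitehead hκ hA rk.injective δ
  have mk_eq : lift.{v} #A = lift.{w} #κ := lift_mk_eq'.2 ⟨rk⟩
  have aleph0_lt : ℵ₀ < #A := by rwa [← lift_lt.{w, v}, mk_eq, lift_aleph0, aleph0_lt_lift]
  have relWhitehead (T : Set A) (hT : #T < #A) : RelWhitehead (rankFiltration rk α) T := by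
    obtain ⟨β, hβ⟩ := exists_forall_lt_of_lift_mk_lt_cof (κ := κ)
      (by simpa [← mk_eq] using hT) fun x : T ↦ rk x
    exact (hα β).mono fun x hx ↦ hβ ⟨x, hx⟩
  obtain ⟨b, hb⟩ := RelWhitehead.exists_notMem_sup_range_zsmul hp (rankFiltration_ne_top hκ rk α)
    fun T hT ↦ relWhitehead T (hT.le_aleph0.trans_lt aleph0_lt)
  exact ⟨_, b, rankFiltration_mono rk hδα, relWhitehead, hb⟩

end rankFiltration

namespace ExtAb

variable {B X I : Type u} [AddCommGroup B] [AddCommGroup X] [AddCommGroup I]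

theorem exists_lift {N : Type u} [AddCommGroup N] (h : Subsingleton (ExtAb B X)) {i : X →+ I}
    {p : I →+ N} (hi : Function.Injective i) (hp : Function.Surjective p)
    (hip : Function.Exact i p) (f : B →+ N) : ∃ g : B →+ I, p.comp g = f := by
  let S : CategoryTheory.ShortComplex (ModuleCat.{u} ℤ) :=
    .mk (ModuleCat.ofHom i.toIntLinearMap) (ModuleCat.ofHom p.toIntLinearMap) (by
      ext x
      exact hip.apply_apply_eq_zero x)
  have hS : S.ShortExact := by
    have : CategoryTheory.Mono S.f := (ModuleCat.mono_iff_injective _).2 hi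
    have : CategoryTheory.Epi S.g := (ModuleCat.epi_iff_surjective _).2 hp
    exact { exact := ModuleCat.shortComplex_exact S hip }
  obtain ⟨x, hx⟩ := CategoryTheory.Abelian.Ext.covariant_sequence_exact₃ (ModuleCat.of ℤ B) hS
    (CategoryTheory.Abelian.Ext.mk₀ (ModuleCat.ofHom f.toIntLinearMap : ModuleCat.of ℤ B ⟶ S.X₃))
    (zero_add 1) (h.elim _ _)
  obtain ⟨g, rfl⟩ := (CategoryTheory.Abelian.Ext.mk₀_bijective _ _).2 x
  rw [CategoryTheory.Abelian.Ext.mk₀_comp_mk₀] at hx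
  refine ⟨g.hom.toAddMonoidHom, ?_⟩
  ext b
  exact congrArg (fun k ↦ k.hom b) ((CategoryTheory.Abelian.Ext.mk₀_bijective _ _).1 hx)

theorem exists_apply_eq_on_relations {F : Type*} [AddCommGroup F] {K : AddSubgroup F}
    (e : B ≃+ F ⧸ K) (h : Subsingleton (ExtAb B X)) {i : X →+ I} (hi : Function.Injective i)
    {ψ : F →+ I} (hψ : ∀ k ∈ K, ψ k ∈ i.range) : ∃ φ : F →+ X, ∀ k ∈ K, i (φ k) = ψ k := by
  let ψ' : F ⧸ K →+ I ⧸ i.range := QuotientAddGroup.map K i.range ψ hψ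
  obtain ⟨θ, hθ⟩ := exists_lift h hi (QuotientAddGroup.mk'_surjective i.range)
    (fun x ↦ QuotientAddGroup.eq_zero_iff x) (ψ'.comp e.toAddMonoidHom)
  let q : F →+ B := e.symm.toAddMonoidHom.comp (QuotientAddGroup.mk' K)
  have sub_mem_range (x : F) : (ψ - θ.comp q) x ∈ i.range := by
    have hθx : (θ (q x) : I ⧸ i.range) = ψ x :=
      (DFunLike.congr_fun hθ (q x)).trans (congrArg ψ' (e.apply_symm_apply (x : F ⧸ K)))
    rw [← QuotientAddGroup.eq_zero_iff, AddMonoidHom.sub_apply, QuotientAddGroup.mk_sub,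
      AddMonoidHom.comp_apply, hθx, sub_self]
  refine ⟨(AddMonoidHom.ofInjective hi).symm.toAddMonoidHom.comp
    ((ψ - θ.comp q).codRestrict i.range sub_mem_range), fun k hk ↦ ?_⟩
  have q_eq_zero : q k = 0 :=
    (congrArg e.symm ((QuotientAddGroup.eq_zero_iff k).2 hk)).trans (map_zero _)
  calc _ = ψ k - θ (q k) := AddMonoidHom.apply_ofInjective_symm hi _
    _ = ψ k := by rw [q_eq_zero, map_zero, sub_zero]

end ExtAb

theorem IsWhitehead.relWhitehead_bot_univ {A : Type u} [AddCommGroup A] (hA : IsWhitehead A) :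
    RelWhitehead (⊥ : AddSubgroup A) Set.univ := by
  intro f _
  let i : ULift.{u} ℤ →+ ULift.{u} ℚ := AddEquiv.ulift.symm.toAddMonoidHom.comp
    ((Int.castAddHom ℚ).comp AddEquiv.ulift.toAddMonoidHom)
  let p : ULift.{u} ℚ →+ ULift.{u} (AddCircle (1 : ℚ)) := AddEquiv.ulift.symm.toAddMonoidHom.comp
    ((QuotientAddGroup.mk' (AddSubgroup.zmultiples (1 : ℚ))).comp AddEquiv.ulift.toAddMonoidHom)
  have hi : Function.Injective i := fun a b h ↦
    ULift.ext _ _ (Int.cast_injective (α := ℚ) (congrArg ULift.down h))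
  have hp : Function.Surjective p := fun ⟨x⟩ ↦
    let ⟨q, hq⟩ := QuotientAddGroup.mk_surjective x
    ⟨⟨q⟩, ULift.ext _ _ hq⟩
  have hip : Function.Exact i p := by
    rintro ⟨q⟩
    calc p ⟨q⟩ = 0 ↔ (q : AddCircle (1 : ℚ)) = (0 : ℚ) := ULift.ext_iff
      _ ↔ ∃ z : ℤ, q - 0 = z := addCircle_one_coe_eq_coe_iff
      _ ↔ _ := ⟨fun ⟨z, hz⟩ ↦ ⟨⟨z⟩, ULift.ext _ _ (hz.symm.trans (sub_zero q))⟩,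
        fun ⟨⟨z⟩, hz⟩ ↦ ⟨z, (sub_zero q).trans (congrArg ULift.down hz).symm⟩⟩
  obtain ⟨g, hg⟩ := ExtAb.exists_lift hA hi hp hip (AddEquiv.ulift.symm.toAddMonoidHom.comp f)
  exact ⟨(AddEquiv.ulift (α := ℚ)).toAddMonoidHom.comp g, by simp, fun a _ ↦
    congrArg ULift.down (DFunLike.congr_fun hg a)⟩

theorem exists_zsmul_succ_sub_eq {I : Type*} [AddCommGroup I] [DivisibleBy I ℤ] {p : ℤ}
    (hp : p ≠ 0) (t : ℕ → I) : ∃ y : ℕ → I, ∀ n, p • y (n + 1) - y n = t n :=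
  ⟨fun n ↦ Nat.rec 0 (fun n x ↦ DivisibleBy.div (x + t n) p) n, fun n ↦ by
    rw [DivisibleBy.div_cancel _ hp, add_sub_cancel_left]⟩

namespace BuildingData

variable {μ : Cardinal.{u}} (D : BuildingData μ)

open Classical in
theorem map_w {B : Type*} [AddCommGroup B] (f : D.F →+ B) (δ : D.S) (ν : D.E) (n : ℕ) :
    f (D.w δ ν n) = (2 : ℤ) • f (.of (.y δ ν (n + 1))) - f (.of (.y δ ν n))
      - (if hσ : ℵ₀ < μ.ord.cof then f (.of (.z hσ δ (D.zetaVal hσ ν n))) else 0)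
      + f (.of (.x (D.etaVal δ (D.shift ν n)))) := by
  rw [w, map_add, map_sub, map_sub, map_zsmul, apply_dite f]
  simp only [map_zero]

theorem IsBuiltOn.exists_hom {D : BuildingData μ} {H A : Type u} [AddCommGroup H] [AddCommGroup A]
    (hH : D.IsBuiltOn H) (h : Subsingleton (ExtAb H A)) (a : D.S → D.E → ℕ → A) :
    ∃ φ : D.F →+ A, ∀ δ ν n, φ (D.w δ ν n) = a δ ν n := by
  obtain ⟨e⟩ := hH
  obtain ⟨I, _, _, i, hi⟩ := exists_injective_hom_divisible A
  choose y hy using fun δ ν ↦ exists_zsmul_succ_sub_eq (two_ne_zero (α := ℤ)) fun n ↦ i (a δ ν n)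
  let ψ : D.F →+ I := FreeAbelianGroup.lift fun
    | .y δ ν n => y δ ν n
    | .z _ _ _ => 0
    | .x _ => 0
  have hψ (δ ν n) : ψ (D.w δ ν n) = i (a δ ν n) := by
    simp [map_w, ψ, hy]
  have K_le : D.K ≤ i.range.comap ψ := by
    rw [K, AddSubgroup.closure_le]
    rintro _ ⟨δ, ν, n, rfl⟩
    exact ⟨a δ ν n, (hψ δ ν n).symm⟩
  obtain ⟨φ, hφ⟩ := ExtAb.exists_apply_eq_on_relations e h hi K_le
  exact ⟨φ, fun δ ν n ↦ hi ((hφ _ (AddSubgroup.subset_closure ⟨δ, ν, n, rfl⟩)).trans (hψ δ ν n))⟩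

/-- The generators `y_{δ,ν,n}` and `z_{δ,j}` attached to a fixed `δ ∈ S`. -/
def localGen (δ : D.S) : Set D.Gen :=
  (Set.range fun i : D.E × ℕ ↦ .y δ i.1 i.2) ∪ ⋃ hσ, Set.range (.z hσ δ)

theorem mk_localGen_le (δ : D.S) : #(D.localGen δ) ≤ lift.{u + 1} μ := by
  have aleph0_le : ℵ₀ ≤ lift.{u + 1} μ := aleph0_le_lift.2 D.aleph0_le
  have mk_Iio_le : #(Set.Iio μ.ord.cof.ord) ≤ lift.{u + 1} μ := by
    rw [mk_Iio_ordinal, card_ord, lift_le]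
    exact Ordinal.cof_ord_le μ
  have mk_E_le : #D.E ≤ lift.{u + 1} μ := (mk_le_mk_of_subset D.E_lt).trans mk_Iio_le
  refine (mk_union_le _ _).trans (add_le_of_le aleph0_le ?_ ?_)
  · refine mk_range_le.trans ?_
    rw [mk_prod]
    simpa using mul_le_of_le aleph0_le mk_E_le aleph0_le
  · by_cases hσ : ℵ₀ < μ.ord.cof
    · simpa [hσ] using mk_range_le.trans mk_Iio_le
    · simp [hσ]

theorem mk_insert_image_localGen_lt (δ : D.S) {A : Type u} (f : D.Gen → A) (b : A) :
    #(insert b (f '' D.localGen δ) : Set A) < Order.succ μ := by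
  have mk_image_le : #(f '' D.localGen δ) ≤ μ := by
    rw [← lift_le.{u + 1}, ← lift_id'.{u, u + 1} (lift.{u + 1} μ)]
    exact mk_image_le_lift.trans (lift_le.2 (D.mk_localGen_le δ))
  exact Order.lt_succ_iff.2 (mk_insert_le.trans
    (add_le_of_le D.aleph0_le mk_image_le (one_le_aleph0.trans D.aleph0_le)))

open Classical in
theorem exists_coloring_not_recursionSolvable (hE : ℵ₀ < μ.ord.cof → Diamond μ.ord.cof D.E) :
    ∃ ε : D.E → ℕ → Bool, ∀ m : ℤ, m ≠ 0 → ∀ Z : ℵ₀ < μ.ord.cof → Set.Iio μ.ord.cof.ord → ℤ,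
      ∃ ν, ¬ RecursionSolvable 2 fun n ↦
        (if hσ : ℵ₀ < μ.ord.cof then Z hσ (D.zetaVal hσ ν n) else 0) + m * (ε ν n).toNat := by
  have isRegular_cof : μ.ord.cof.IsRegular := isRegular_cof (isSuccLimit_ord D.aleph0_le)
  by_cases hσ : ℵ₀ < μ.ord.cof
  · have := isRegularCardinalOrder_Iio_ord isRegular_cof
    obtain ⟨ε, hε⟩ := (hE hσ).diamondOn.exists_coloring_not_recursionSolvable (p := 2)
      (by rwa [mk_Iio_ordinal, card_ord, aleph0_lt_lift]) (by decide)
      (ζ := fun ν n ↦ D.zetaVal hσ ⟨ν, ν.2⟩ n) fun ν n ↦ ((D.ζ hσ).ladder ⟨ν, ν.2⟩ n).2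
    refine ⟨fun ν ↦ ε ⟨⟨ν, D.E_lt ν ν.2⟩, ν.2⟩, fun m hm Z ↦ ?_⟩
    obtain ⟨ν, hν⟩ := hε m hm (Z hσ)
    exact ⟨⟨ν, ν.2⟩, by simpa only [dif_pos hσ] using hν⟩
  · obtain ⟨ε, hε⟩ := exists_forall_not_recursionSolvable (p := 2) (by decide)
      (fun _ _ ↦ 0) (m := ((↑) : {m : ℤ // m ≠ 0} → ℤ)) Subtype.prop
    have zero_mem : (0 : Ordinal.{u}) ∈ D.E := by
      rw [D.E_eq (le_antisymm (not_lt.1 hσ) isRegular_cof.aleph0_le)]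
      rfl
    exact ⟨fun _ ↦ ε, fun m hm Z ↦ ⟨⟨0, zero_mem⟩, by simpa only [dif_neg hσ] using hε ⟨m, hm⟩⟩⟩

theorem exists_coloring_map_w_ne (hE : ℵ₀ < μ.ord.cof → Diamond μ.ord.cof D.E) :
    ∃ ε : D.E → ℕ → Bool, ∀ (δ : D.S) (m : ℤ), m ≠ 0 → ∀ g : D.F →+ ℚ,
      (∀ a ∈ D.localGen δ, ∃ k : ℤ, g (.of a) = k) → (∀ i, g (.of (.x (D.etaVal δ i))) = 0) →
        ∃ ν n, g (D.w δ ν n) ≠ m * (ε ν n).toNat := by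
  classical
  obtain ⟨ε, hε⟩ := D.exists_coloring_not_recursionSolvable hE
  refine ⟨ε, fun δ m hm g hg hgx ↦ ?_⟩
  by_contra! hw
  choose Y hY using fun ν n ↦ hg (.y δ ν n) (.inl ⟨(ν, n), rfl⟩)
  choose Z hZ using fun hσ j ↦ hg (.z hσ δ j) (.inr (Set.mem_iUnion.2 ⟨hσ, j, rfl⟩))
  obtain ⟨ν, hν⟩ := hε m hm Z
  refine hν ⟨Y ν, fun n ↦ ?_⟩
  have hwn := hw ν n
  simp only [map_w, hY, hZ, hgx] at hwn
  qify
  split_ifs at hwn ⊢ <;> push_cast [zsmul_eq_mul] at hwn ⊢ <;> linear_combination hwn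

end BuildingData

theorem mainTheorem8_general
    (μ : Cardinal.{u})
    (D : BuildingData μ)
    (hS : StationaryIn (Order.succ μ).ord D.S)
    (Y : Set Ordinal.{u})
    (hY : Diamond (Order.succ μ) Y)
    (hE : ℵ₀ < μ.ord.cof → Diamond μ.ord.cof D.E)
    (H : Type u) [AddCommGroup H] (hH : D.IsBuiltOn H)
    (A : Type u) [AddCommGroup A] (hA : IsWhitehead A) (hA_card : #A = Order.succ μ) :
    Nontrivial (ExtAb H A) := by
  have aleph0_lt_mk : ℵ₀ < #(Set.Iio (Order.succ μ).ord) := by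
    simpa using D.aleph0_le
  have := isRegularCardinalOrder_Iio_ord (isRegular_succ D.aleph0_le)
  obtain ⟨rk⟩ : Nonempty (A ≃ Set.Iio (Order.succ μ).ord) := by
    rw [← lift_mk_eq', mk_Iio_ordinal, card_ord, hA_card, lift_lift]
  by_contra hExt
  choose U b rankFiltration_le hU hb using fun δ : D.S ↦
    hY.diamondOn.exists_rankFiltration_le aleph0_lt_mk hA.relWhitehead_bot_univ rk
      (p := 2) (by decide) ⟨δ, D.S_lt δ δ.2⟩
  obtain ⟨ε, hε⟩ := D.exists_coloring_map_w_ne hE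
  obtain ⟨φ, hφ⟩ := hH.exists_hom (not_nontrivial_iff_subsingleton.1 hExt)
    fun δ ν n ↦ (ε ν n).toNat • b δ
  obtain ⟨⟨δ, hδ_lt⟩, hδ, φ_x_lt⟩ :=
    hS (isClub_setOf_forall_lt_apply_lt aleph0_lt_mk fun β ↦ rk (φ (.of (.x β))))
  lift δ to D.S using hδ
  obtain ⟨g, hgU, hg, hgb⟩ := (hU δ _ ((D.mk_insert_image_localGen_lt δ _ _).trans_eq
    hA_card.symm)).exists_integral two_ne_zero (Set.mem_insert _ _) (hb δ)
  obtain ⟨m, hm⟩ := hg _ (Set.mem_insert _ _)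
  obtain ⟨ν, n, hne⟩ := hε δ m (by rintro rfl; simp [hm] at hgb) (g.comp φ)
    (fun a ha ↦ hg _ (Set.mem_insert_of_mem _ ⟨a, ha, rfl⟩)) fun i ↦
      hgU _ (rankFiltration_le δ (mem_rankFiltration (φ_x_lt _ (D.η.ladder δ i).2)))
  refine hne ?_
  rw [AddMonoidHom.comp_apply, hφ, map_nsmul, hm, nsmul_eq_mul, mul_comm]

theorem mainTheorem8
    (gch : GCH.{u})
    (μ : Cardinal.{u}) (hμ : μ.IsSingular)
    (D : BuildingData μ)
    (hS : StationaryIn (Order.succ μ).ord D.S)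
    (Y : Set Ordinal.{u})
    (hY_lt : ∀ α ∈ Y, α < (Order.succ μ).ord)
    (hY_cof : ∀ α ∈ Y, α.cof = μ.ord.cof)
    (hY : Diamond (Order.succ μ) Y)
    (hE : ℵ₀ < μ.ord.cof → Diamond μ.ord.cof D.E)
    (H : Type u) [AddCommGroup H] (hH : D.IsBuiltOn H)
    (A : Type u) [AddCommGroup A] (hA : IsWhitehead A) (hA_card : #A = Order.succ μ) :
    Nontrivial (ExtAb H A) :=
  mainTheorem8_general μ D hS Y hY hE H hH A hA hA_card
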